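/- Let $G$ be a locally compact Hausdorff group and $K$ a compact subgroup with normalized Haar measure $\omega$. Let $\mathcal C(G)$ be the space of continuous functions $G\to\mathbb C$ with uniform convergence on compact sets; its dual, with the weak* topology, is the space $\mathcal M_c(G)$ of compactly supported complex measures, with convolution $\langle\mu*\nu,f\rangle=\int\int f(xy)\,d\mu(x)\,d\nu(y)$ and action $(\mu*f)(x)=\int f(y^{-1}x)\,d\mu(y)$. Put $f^{\#}(x)=\int_K\int_K f(kxl)\,d\omega(k)\,d\omega(l)$ and $\langle\mu^{\#},f\rangle=\langle\mu,f^{\#}\rangle$. Let $\mathcal C(G//K)=\{f: f(kxl)=f(x)\ \text{for all } k,l\in K,\ x\in G\}$, and let $\mathcal A=\mathcal M_c(G//K)=\{\mu:\mu=\mu^{\#}\}$, an algebra with unit $\delta_e^{\#}$ (which acts on $\mathcal C(G//K)$ as $\delta_e$). Assume that $(G,K)$ is a Gelfand pair, that is, $\mathcal A$ is commutative. A $K$-variety is a closed linear subspace of $\mathcal C(G//K)$ invariant under all $K$-translations $\tau_yf=\delta_{y^{-1}}^{\#}*f$, $y\in G$; $\tau(\varphi)$ is the smallest $K$-variety containing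 $\varphi$. For a $K$-variety $V$ let $\mathrm{Ann}\,V=\{\mu\in\mathcal A:\mu*f=0\ \text{for all } f\in V\}$. A $K$-spherical function is a nonzero $s\in\mathcal C(G//K)$ with $\int_K s(xky)\,d\omega(k)=s(x)s(y)$ for all $x,y$; put $D_{s;y}=\delta_{y^{-1}}^{\#}-s(y)\,\delta_e^{\#}$. A $K$-spherical monomial is a $\varphi\in\mathcal C(G//K)$ such that $\tau(\varphi)$ is finite dimensional and, for some $K$-spherical function $s$ and some $n\in\mathbb N$, $D_{s;y_1}*\dots*D_{s;y_{n+1}}*\varphi=0$ for all $y_1,\dots,y_{n+1}\in G$. The $K$-variety $V$ is $K$-synthesizable if the $K$-spherical monomials belonging to $V$ span a dense subspace of $V$. A maximal ideal of $\mathcal A$ is exponential if it is the kernel of a continuous algebra homomorphism of $\mathcal A$ onto $\mathbb C$; for such $M$, $M^{n+1}$ denotes the closed power, i.e. the closure of the linear span of all products of $n+1$ elements of $M$. Theorem. Let $V$ be a nonzero $K$-variety. Suppose that $\mathcal A/M^{n+1}$ is finite dimensional for every exponential maximal ideal $M\supseteq\mathrm{Ann}\,V$ and every $n\in\mathbb N$.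 Then $V$ is $K$-synthesizable if and only if $$\mathrm{Ann}\,V=\bigcap_{M}\ \bigcap_{n\in\mathbb N}\bigl(\mathrm{Ann}\,V+M^{n+1}\bigr),\qquad(*)$$ where $M$ runs over all exponential maximal ideals containing $\mathrm{Ann}\,V$. Moreover, without the supposition on the quotients: if $V$ is $K$-synthesizable then $(*)$ holds; and if $(*)$ holds with the intersection restricted to those pairs $(M,n)$ for which $\mathcal A/M^{n+1}$ is finite dimensional, then $V$ is $K$-synthesizable. -/

import Mathlib

open MeasureTheory

namespace SphericalSynthesis

noncomputable section

section Slices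

/-! ### Applying a functional in one of two variables -/

variable {X Y Z : Type*} [TopologicalSpace X] [TopologicalSpace Y] [TopologicalSpace Z]
  [LocallyCompactSpace X] [LocallyCompactSpace Y]

/-- For a continuous map `p : X × Y → Z` and a continuous linear functional `ν` on `C(Y, ℂ)`, the
operator sending `f : C(Z, ℂ)` to the continuous function `x ↦ ν (y ↦ f (p (x, y)))`. -/
def slice (p : C(X × Y, Z)) (ν : C(Y, ℂ) →L[ℂ] ℂ) : C(Z, ℂ) →L[ℂ] C(X, ℂ) where
  toFun f := ContinuousMap.comp ⟨fun g : C(Y, ℂ) => ν g, map_continuous ν⟩ (f.comp p).curry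
  map_add' f g := by
    ext x
    exact map_add ν ((f.comp p).curry x) ((g.comp p).curry x)
  map_smul' c f := by
    ext x
    exact map_smul ν c ((f.comp p).curry x)
  cont := (ContinuousMap.continuous_postcomp _).comp
    (ContinuousMap.continuous_curry.comp (ContinuousMap.continuous_precomp p))

theorem slice_apply (p : C(X × Y, Z)) (ν : C(Y, ℂ) →L[ℂ] ℂ) (f : C(Z, ℂ)) (x : X) :
    slice p ν f x = ν ((f.comp p).curry x) := rfl

end Slices

section Fubini

variable {X Y : Type*} [TopologicalSpace X] [TopologicalSpace Y]

/-- A continuous linear functional on `C(X, ℂ)` factors through the restriction to a compact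
set. -/
theorem exists_compact_factor (μ : C(X, ℂ) →L[ℂ] ℂ) :
    ∃ L : Set X, ∃ _ : CompactSpace L, ∃ μ' : C(L, ℂ) →L[ℂ] ℂ,
      ∀ f : C(X, ℂ), μ f = μ' (f.restrict L) := by
  have h0 : {f : C(X, ℂ) | ‖μ f‖ < 1} ∈ nhds (0 : C(X, ℂ)) := by
    apply (isOpen_lt (by fun_prop) continuous_const).mem_nhds
    simp
  have hb := nhds_basis_uniformity' (x := (0 : C(X, ℂ)))
    (Metric.uniformity_basis_dist (α := ℂ)).compactConvergenceUniformity
  rw [hb.mem_iff] at h0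
  obtain ⟨⟨L, ε⟩, ⟨hL, hε⟩, hsub⟩ := h0
  simp only at hL hε hsub
  have : CompactSpace L := isCompact_iff_compactSpace.mp hL
  let r : C(X, ℂ) →ₗ[ℂ] C(L, ℂ) :=
    { toFun := fun f => f.restrict L, map_add' := fun _ _ => rfl, map_smul' := fun _ _ => rfl }
  have hbound : ∀ f, ‖μ f‖ ≤ ε⁻¹ * ‖r f‖ := by
    intro f
    have key : ∀ t, ‖r f‖ < t → ‖μ f‖ ≤ ε⁻¹ * t := by
      intro t ht
      have ht0 : 0 < t := (norm_nonneg _).trans_lt ht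
      have hmem : ((ε / t : ℝ) : ℂ) • f ∈ {f : C(X, ℂ) | ‖μ f‖ < 1} := by
        apply hsub
        intro x hx
        have h1 : ‖f x‖ ≤ ‖r f‖ := (r f).norm_coe_le_norm ⟨x, hx⟩
        have h2 : ‖f x‖ < t := h1.trans_lt ht
        have h3 : ‖((ε / t : ℝ) : ℂ)‖ = ε / t := by
          rw [Complex.norm_real, Real.norm_of_nonneg (by positivity)]
        show dist ((0 : C(X, ℂ)) x) (((ε / t : ℝ) : ℂ) • f x) < ε
        rw [ContinuousMap.zero_apply, dist_zero_left, norm_smul, h3]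
        calc ε / t * ‖f x‖ < ε / t * t := by gcongr
          _ = ε := by field_simp
      have h3 : ‖((ε / t : ℝ) : ℂ)‖ = ε / t := by
        rw [Complex.norm_real, Real.norm_of_nonneg (by positivity)]
      rw [Set.mem_ofPred_eq, map_smul, norm_smul, h3] at hmem
      have : ‖μ f‖ = ε⁻¹ * t * (ε / t * ‖μ f‖) := by field_simp
      rw [this]
      exact mul_le_of_le_one_right (by positivity) hmem.le
    rw [← div_eq_inv_mul, le_div_iff₀ hε]
    apply le_of_forall_gt_imp_ge_of_dense
    intro t ht
    have := key t ht
    rwa [← div_eq_inv_mul, le_div_iff₀ hε] at this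
  have hker : LinearMap.ker r ≤ LinearMap.ker μ.toLinearMap := by
    intro f hf
    have h1 := hbound f
    rw [LinearMap.mem_ker.mp hf] at h1
    simpa using h1
  let g : LinearMap.range r →ₗ[ℂ] ℂ :=
    ((LinearMap.ker r).liftQ μ.toLinearMap hker).comp r.quotKerEquivRange.symm.toLinearMap
  have hg : ∀ f, g ⟨r f, LinearMap.mem_range_self r f⟩ = μ f := by
    intro f
    have : r.quotKerEquivRange.symm ⟨r f, LinearMap.mem_range_self r f⟩
        = (LinearMap.ker r).mkQ f := by
      rw [LinearEquiv.symm_apply_eq]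
      rfl
    show (LinearMap.ker r).liftQ μ.toLinearMap hker (r.quotKerEquivRange.symm _) = _
    rw [this]
    rfl
  let gc : StrongDual ℂ (LinearMap.range r) := g.mkContinuous ε⁻¹ (by
    rintro ⟨_, f, rfl⟩
    rw [hg]
    exact hbound f)
  obtain ⟨μ', hμ', -⟩ := exists_extension_norm_eq (LinearMap.range r) gc
  refine ⟨L, this, μ', fun f => ?_⟩
  exact ((hμ' ⟨r f, LinearMap.mem_range_self r f⟩).trans (hg f)).symm

/-- A continuous linear functional on `C(X, ℂ)` commutes with integration over a compact space of
parameters. -/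
theorem functional_integral_comm [CompactSpace Y] [MeasurableSpace Y] [BorelSpace Y]
    (ω : Measure Y) [IsFiniteMeasure ω] (μ : C(X, ℂ) →L[ℂ] ℂ) (F : C(Y, C(X, ℂ)))
    (g : C(X, ℂ)) (hg : ∀ x, g x = ∫ k, F k x ∂ω) :
    μ g = ∫ k, μ (F k) ∂ω := by
  obtain ⟨L, hL, μ', hμ'⟩ := exists_compact_factor μ
  have hF : Continuous fun k => (F k).restrict L :=
    (ContinuousMap.continuous_precomp (⟨Subtype.val, continuous_subtype_val⟩ : C(L, X))).comp
      F.continuous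
  have hint : Integrable (fun k => (F k).restrict L) ω :=
    hF.integrable_of_hasCompactSupport (HasCompactSupport.of_compactSpace _)
  have hgr : g.restrict L = ∫ k, (F k).restrict L ∂ω := by
    ext x
    rw [ContinuousMap.integral_apply hint]
    exact hg x
  simp only [hμ', hgr]
  exact (μ'.integral_comp_comm hint).symm

end Fubini

section Pair

set_option linter.unusedSectionVars false

variable {G : Type*} [Group G] [TopologicalSpace G] [IsTopologicalGroup G] [LocallyCompactSpace G]

/-! ### Compactly supported measures, convolution -/

variable (G) in
/-- The space `M_c(G)` of compactly supported complex measures on `G`, as the dual of `C(G)`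
(uniform convergence on compact sets), with the weak-* topology. -/
def CompactMeasure : Type _ := WeakDual ℂ C(G, ℂ)

namespace CompactMeasure

instance : AddCommGroup (CompactMeasure G) :=
  inferInstanceAs (AddCommGroup (WeakDual ℂ C(G, ℂ)))

instance : Module ℂ (CompactMeasure G) :=
  inferInstanceAs (Module ℂ (WeakDual ℂ C(G, ℂ)))

instance : TopologicalSpace (CompactMeasure G) :=
  inferInstanceAs (TopologicalSpace (WeakDual ℂ C(G, ℂ)))

instance : IsTopologicalAddGroup (CompactMeasure G) :=
  inferInstanceAs (IsTopologicalAddGroup (WeakDual ℂ C(G, ℂ)))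

instance : ContinuousSMul ℂ (CompactMeasure G) :=
  inferInstanceAs (ContinuousSMul ℂ (WeakDual ℂ C(G, ℂ)))

instance : FunLike (CompactMeasure G) C(G, ℂ) ℂ :=
  inferInstanceAs (FunLike (WeakDual ℂ C(G, ℂ)) C(G, ℂ) ℂ)

instance : ContinuousLinearMapClass (CompactMeasure G) ℂ C(G, ℂ) ℂ :=
  inferInstanceAs (ContinuousLinearMapClass (WeakDual ℂ C(G, ℂ)) ℂ C(G, ℂ) ℂ)

/-- The measure given by a continuous linear functional on `C(G)`. -/
def of (Λ : C(G, ℂ) →L[ℂ] ℂ) : CompactMeasure G := StrongDual.toWeakDual Λ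

/-- The continuous linear functional `f ↦ ⟨μ, f⟩`. -/
def toFunctional (μ : CompactMeasure G) : C(G, ℂ) →L[ℂ] ℂ :=
  WeakDual.toStrongDual (𝕜 := ℂ) (E := C(G, ℂ)) μ

end CompactMeasure

/-- The operator taking `f` to `x ↦ ∫ f (x y) dν(y)`. -/
def mulSlice (ν : CompactMeasure G) : C(G, ℂ) →L[ℂ] C(G, ℂ) :=
  slice ⟨fun p : G × G => p.1 * p.2, by fun_prop⟩ ν.toFunctional

theorem mulSlice_apply (ν : CompactMeasure G) (f : C(G, ℂ)) (x : G) :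
    mulSlice ν f x = ν (f.comp ⟨fun y => x * y, by fun_prop⟩) := rfl

/-- `⟨μ * ν, f⟩ = ∫∫ f (x y) dμ(x) dν(y)`. -/
def conv (μ ν : CompactMeasure G) : CompactMeasure G :=
  .of (μ.toFunctional.comp (mulSlice ν))

/-- `(μ * f)(x) = ∫ f (y⁻¹ x) dμ(y)`. -/
def convFun (μ : CompactMeasure G) (f : C(G, ℂ)) : C(G, ℂ) :=
  slice ⟨fun p : G × G => p.2⁻¹ * p.1, by fun_prop⟩ μ.toFunctional f

/-- The point mass at `y`. -/
def dirac (y : G) : CompactMeasure G :=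
  .of
    { toFun := fun f : C(G, ℂ) => f y
      map_add' := fun _ _ => rfl
      map_smul' := fun _ _ => rfl
      cont := continuous_eval_const y }

variable [T2Space G] [MeasurableSpace G] [BorelSpace G] (K : Subgroup G) [CompactSpace K]

/-! ### The compact subgroup and projections -/

/-- The normalized Haar measure of the compact subgroup `K`. -/
def haarK : Measure K := Measure.haarMeasure ⊤

instance : IsProbabilityMeasure (haarK K) :=
  ⟨by simpa [haarK] using Measure.haarMeasure_self (K₀ := (⊤ : TopologicalSpace.PositiveCompacts K))⟩

instance : (haarK K).IsMulLeftInvariant := by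
  unfold haarK; infer_instance

theorem integrable_haarK (f : C(K, ℂ)) : Integrable f (haarK K) :=
  f.continuous.integrable_of_hasCompactSupport (HasCompactSupport.of_compactSpace _)

/-- Integration over `K` as a functional on `C(K)`. -/
def intK : C(K, ℂ) →L[ℂ] ℂ :=
  LinearMap.mkContinuous
    { toFun := fun f : C(K, ℂ) => ∫ k, f k ∂(haarK K)
      map_add' := fun f g => integral_add (integrable_haarK K f) (integrable_haarK K g)
      map_smul' := fun c f => integral_smul c f } 1 (fun f => by
        rw [one_mul]
        refine (norm_integral_le_of_norm_le_const (C := ‖f‖)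
          (Filter.Eventually.of_forall f.norm_coe_le_norm)).trans ?_
        simp)

theorem intK_apply (f : C(K, ℂ)) : intK K f = ∫ k, f k ∂(haarK K) := rfl

/-- `x ↦ ∫ f (k x) dω(k)`. -/
def leftAvg : C(G, ℂ) →L[ℂ] C(G, ℂ) :=
  slice ⟨fun p : G × K => (p.2 : G) * p.1, by fun_prop⟩ (intK K)

/-- `x ↦ ∫ f (x k) dω(k)`. -/
def rightAvg : C(G, ℂ) →L[ℂ] C(G, ℂ) :=
  slice ⟨fun p : G × K => p.1 * (p.2 : G), by fun_prop⟩ (intK K)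

theorem leftAvg_apply (f : C(G, ℂ)) (x : G) :
    leftAvg K f x = ∫ k : K, f ((k : G) * x) ∂(haarK K) := rfl

theorem rightAvg_apply (f : C(G, ℂ)) (x : G) :
    rightAvg K f x = ∫ k : K, f (x * (k : G)) ∂(haarK K) := rfl

/-- The projection `f ↦ f^#` of functions. -/
def proj : C(G, ℂ) →L[ℂ] C(G, ℂ) := (leftAvg K).comp (rightAvg K)

theorem proj_apply (f : C(G, ℂ)) (x : G) :
    proj K f x = ∫ k : K, ∫ l : K, f ((k : G) * x * (l : G)) ∂(haarK K) ∂(haarK K) := rfl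

/-- The projection `μ ↦ μ^#` of measures, `⟨μ^#, f⟩ = ⟨μ, f^#⟩`. -/
def measProj (μ : CompactMeasure G) : CompactMeasure G :=
  .of (μ.toFunctional.comp (proj K))

theorem rightAvg_rightAvg (f : C(G, ℂ)) : rightAvg K (rightAvg K f) = rightAvg K f := by
  ext x
  simp only [rightAvg_apply]
  have : ∀ k : K, ∫ l : K, f (x * (k : G) * (l : G)) ∂(haarK K)
      = ∫ l : K, f (x * (l : G)) ∂(haarK K) := by
    intro k
    rw [← integral_mul_left_eq_self (μ := haarK K) (fun l : K => f (x * (l : G))) k]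
    simp [mul_assoc]
  simp [this]

theorem integral_swap_K (F : K → K → ℂ) (hF : Continuous (Function.uncurry F)) :
    ∫ k, ∫ l, F k l ∂(haarK K) ∂(haarK K) = ∫ l, ∫ k, F k l ∂(haarK K) ∂(haarK K) :=
  integral_integral_swap_of_hasCompactSupport hF (HasCompactSupport.of_compactSpace _)

theorem leftAvg_leftAvg (f : C(G, ℂ)) : leftAvg K (leftAvg K f) = leftAvg K f := by
  ext x
  simp only [leftAvg_apply]
  rw [integral_swap_K K (fun k l => f ((l : G) * ((k : G) * x))) (by unfold Function.uncurry; fun_prop)]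
  have : ∀ l : K, ∫ k : K, f ((l : G) * ((k : G) * x)) ∂(haarK K)
      = ∫ k : K, f ((k : G) * x) ∂(haarK K) := by
    intro l
    rw [← integral_mul_left_eq_self (μ := haarK K) (fun k : K => f ((k : G) * x)) l]
    simp [mul_assoc]
  simp [this]

theorem leftAvg_rightAvg (f : C(G, ℂ)) :
    leftAvg K (rightAvg K f) = rightAvg K (leftAvg K f) := by
  ext x
  simp only [leftAvg_apply, rightAvg_apply]
  rw [integral_swap_K K (fun k l => f ((k : G) * x * (l : G))) (by unfold Function.uncurry; fun_prop)]
  simp [mul_assoc]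

theorem proj_leftAvg (f : C(G, ℂ)) : proj K (leftAvg K f) = proj K f := by
  simp [proj, ← leftAvg_rightAvg, leftAvg_leftAvg]

theorem proj_rightAvg (f : C(G, ℂ)) : proj K (rightAvg K f) = proj K f := by
  simp [proj, rightAvg_rightAvg]

theorem proj_proj (f : C(G, ℂ)) : proj K (proj K f) = proj K f := by
  rw [show proj K (proj K f) = proj K (leftAvg K (rightAvg K f)) from rfl, proj_leftAvg,
    proj_rightAvg]

/-! ### The space `C(G//K)` and the algebra `M_c(G//K)` -/

/-- The space `C(G//K)` of `K`-invariant continuous functions. -/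
def KFun : Submodule ℂ C(G, ℂ) where
  carrier := {f | ∀ (x : G) (k l : K), f ((k : G) * x * (l : G)) = f x}
  add_mem' hf hg x k l := by
    simp only [ContinuousMap.add_apply]
    rw [hf x k l, hg x k l]
  zero_mem' _ _ _ := rfl
  smul_mem' c f hf x k l := by
    simp only [ContinuousMap.smul_apply]
    rw [hf x k l]

/-- The space `M_c(G//K)` of `K`-invariant measures, `⟨μ, f⟩ = ⟨μ, f^#⟩` for all `f`. -/
def KMeas : Submodule ℂ (CompactMeasure G) where
  carrier := {μ | ∀ f : C(G, ℂ), μ f = μ (proj K f)}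
  add_mem' := fun {μ ν} hμ hν f => by
    show μ f + ν f = μ (proj K f) + ν (proj K f)
    rw [hμ f, hν f]
  zero_mem' _ := rfl
  smul_mem' c μ hμ f := by
    show c • μ f = c • μ (proj K f)
    rw [hμ f]

variable {K}

theorem KMeas.apply_proj (μ : KMeas K) (f : C(G, ℂ)) :
    (μ : CompactMeasure G) (proj K f) = (μ : CompactMeasure G) f := (μ.2 f).symm

theorem KMeas.apply_leftAvg (μ : KMeas K) (f : C(G, ℂ)) :
    (μ : CompactMeasure G) (leftAvg K f) = (μ : CompactMeasure G) f := by
  rw [← KMeas.apply_proj μ, proj_leftAvg, KMeas.apply_proj μ]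

theorem KMeas.apply_rightAvg (μ : KMeas K) (f : C(G, ℂ)) :
    (μ : CompactMeasure G) (rightAvg K f) = (μ : CompactMeasure G) f := by
  rw [← KMeas.apply_proj μ, proj_rightAvg, KMeas.apply_proj μ]

theorem conv_apply (μ ν : CompactMeasure G) (f : C(G, ℂ)) :
    conv μ ν f = μ (mulSlice ν f) := rfl

theorem mulSlice_leftAvg (ν : CompactMeasure G) (f : C(G, ℂ)) :
    mulSlice ν (leftAvg K f) = leftAvg K (mulSlice ν f) := by
  ext x
  rw [leftAvg_apply, mulSlice_apply]
  refine functional_integral_comm (haarK K) ν.toFunctional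
    (ContinuousMap.curry
      (⟨fun p : K × G => f ((p.1 : G) * x * p.2), by fun_prop⟩ : C(K × G, ℂ))) _ ?_
  intro y
  show leftAvg K f (x * y) = _
  rw [leftAvg_apply]
  simp [mul_assoc]

theorem mulSlice_rightAvg (ν : KMeas K) (f : C(G, ℂ)) :
    mulSlice ν (rightAvg K f) = mulSlice ν f := by
  ext x
  rw [mulSlice_apply, mulSlice_apply, ← KMeas.apply_rightAvg ν (f.comp _)]
  congr 1
  ext y
  simp [rightAvg_apply, mul_assoc]

theorem rightAvg_mulSlice (μ : KMeas K) (f : C(G, ℂ)) :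
    rightAvg K (mulSlice μ f) = mulSlice μ f := by
  ext x
  rw [rightAvg_apply, mulSlice_apply, ← KMeas.apply_leftAvg μ (f.comp _)]
  refine (functional_integral_comm (haarK K) (μ : CompactMeasure G).toFunctional
    (ContinuousMap.curry
      (⟨fun p : K × G => f (x * (p.1 : G) * p.2), by fun_prop⟩ : C(K × G, ℂ))) _ ?_).symm
  intro y
  rw [leftAvg_apply]
  simp [mul_assoc]

theorem conv_mem (μ ν : KMeas K) : conv (μ : CompactMeasure G) ν ∈ KMeas K := by
  intro f
  rw [conv_apply, conv_apply, show proj K f = leftAvg K (rightAvg K f) from rfl, mulSlice_leftAvg,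
    KMeas.apply_leftAvg μ, mulSlice_rightAvg]

theorem measProj_mem (μ : CompactMeasure G) : measProj K μ ∈ KMeas K := by
  intro f
  show μ (proj K f) = μ (proj K (proj K f))
  rw [proj_proj]

variable (K) in
/-- The `K`-invariant measure `δ_y^#`. -/
def deltaK (y : G) : KMeas K := ⟨measProj K (dirac y), measProj_mem _⟩

theorem deltaK_apply (y : G) (f : C(G, ℂ)) :
    (deltaK K y : CompactMeasure G) f = proj K f y := rfl

instance : Mul (KMeas K) := ⟨fun μ ν => ⟨conv (μ : CompactMeasure G) ν, conv_mem μ ν⟩⟩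

/-- The unit of `M_c(G//K)`, `δ_e^#`; as a functional on `C(G//K)` it is `δ_e`. -/
instance : One (KMeas K) := ⟨deltaK K 1⟩

theorem KMeas.mul_apply (μ ν : KMeas K) (f : C(G, ℂ)) :
    ((μ * ν : KMeas K) : CompactMeasure G) f
      = (μ : CompactMeasure G) (mulSlice ν f) := rfl

theorem KMeas.add_apply (μ ν : KMeas K) (f : C(G, ℂ)) :
    ((μ + ν : KMeas K) : CompactMeasure G) f
      = (μ : CompactMeasure G) f + (ν : CompactMeasure G) f := rfl

theorem KMeas.smul_apply (c : ℂ) (μ : KMeas K) (f : C(G, ℂ)) :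
    ((c • μ : KMeas K) : CompactMeasure G) f = c * (μ : CompactMeasure G) f := rfl

theorem KMeas.one_apply (f : C(G, ℂ)) :
    ((1 : KMeas K) : CompactMeasure G) f = proj K f 1 := rfl

theorem KMeas.ext_apply {μ ν : KMeas K}
    (h : ∀ f : C(G, ℂ), (μ : CompactMeasure G) f = (ν : CompactMeasure G) f) : μ = ν :=
  Subtype.ext (DFunLike.ext _ _ h)

/-- The algebra `M_c(G//K)` with convolution as multiplication. -/
instance : Ring (KMeas K) :=
  { (inferInstance : AddCommGroup (KMeas K)), (inferInstance : Mul (KMeas K)),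
    (inferInstance : One (KMeas K)) with
    left_distrib := fun μ ν ρ => KMeas.ext_apply fun f => by
      rw [KMeas.add_apply, KMeas.mul_apply, KMeas.mul_apply, KMeas.mul_apply, ← map_add]
      rfl
    right_distrib := fun μ ν ρ => KMeas.ext_apply fun f => rfl
    zero_mul := fun μ => KMeas.ext_apply fun f => rfl
    mul_zero := fun μ => KMeas.ext_apply fun f => by
      rw [KMeas.mul_apply]
      exact map_zero (μ : CompactMeasure G)
    mul_assoc := fun μ ν ρ => KMeas.ext_apply fun f => by
      rw [KMeas.mul_apply, KMeas.mul_apply, KMeas.mul_apply]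
      congr 1
      ext x
      rw [mulSlice_apply, mulSlice_apply, KMeas.mul_apply]
      congr 1
      ext y
      rw [mulSlice_apply]
      show (ρ : CompactMeasure G) _ = (ρ : CompactMeasure G) _
      congr 1
      ext z
      simp [mul_assoc]
    one_mul := fun μ => KMeas.ext_apply fun f => by
      rw [KMeas.mul_apply, KMeas.one_apply, show proj K (mulSlice μ f)
        = leftAvg K (rightAvg K (mulSlice μ f)) from rfl, rightAvg_mulSlice, ← mulSlice_leftAvg,
        mulSlice_apply, ← KMeas.apply_leftAvg μ f]
      congr 1
      ext y
      simp
    mul_one := fun μ => KMeas.ext_apply fun f => by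
      rw [KMeas.mul_apply, ← KMeas.apply_rightAvg μ f]
      congr 1
      ext x
      rw [mulSlice_apply, KMeas.one_apply, ← rightAvg_rightAvg, proj_apply]
      simp [rightAvg_apply, mul_assoc] }

instance : Algebra ℂ (KMeas K) :=
  Algebra.ofModule
    (fun c μ ν => rfl)
    (fun c μ ν => KMeas.ext_apply fun f => by
      rw [KMeas.smul_apply, KMeas.mul_apply, KMeas.mul_apply]
      exact map_smul (μ : CompactMeasure G) c (mulSlice ν f))

theorem convFun_apply (μ : CompactMeasure G) (f : C(G, ℂ)) (x : G) :
    convFun μ f x = μ (f.comp ⟨fun y => y⁻¹ * x, by fun_prop⟩) := rfl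

theorem convFun_mul (μ ν : KMeas K) (f : C(G, ℂ)) :
    convFun ((μ * ν : KMeas K) : CompactMeasure G) f
      = convFun (μ : CompactMeasure G) (convFun (ν : CompactMeasure G) f) := by
  ext x
  rw [convFun_apply, convFun_apply, KMeas.mul_apply]
  congr 1
  ext y
  rw [mulSlice_apply]
  show _ = convFun (ν : CompactMeasure G) f (y⁻¹ * x)
  rw [convFun_apply]
  congr 1
  ext z
  simp [mul_assoc]

theorem convFun_zero (μ : CompactMeasure G) : convFun μ 0 = 0 := by
  simp [convFun]

variable (K)

/-- `(G, K)` is a Gelfand pair: the algebra `M_c(G//K)` is commutative. -/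
def IsGelfandPair : Prop := ∀ μ ν : KMeas K, μ * ν = ν * μ

/-! ### Varieties, annihilators, exponential maximal ideals -/

/-- The `K`-translation `τ_y f = δ_{y⁻¹}^# * f`. -/
def translate (y : G) (f : C(G, ℂ)) : C(G, ℂ) := convFun (deltaK K y⁻¹ : CompactMeasure G) f

/-- A `K`-variety: a closed `K`-translation invariant linear subspace of `C(G//K)`. -/
structure IsVariety (V : Submodule ℂ C(G, ℂ)) : Prop where
  le_KFun : V ≤ KFun K
  isClosed : IsClosed (V : Set C(G, ℂ))
  translate_mem : ∀ f ∈ V, ∀ y : G, translate K y f ∈ V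

/-- The `K`-variety `τ(f)` generated by `f`. -/
def generated (f : C(G, ℂ)) : Submodule ℂ C(G, ℂ) :=
  sInf {V | IsVariety K V ∧ f ∈ V}

/-- The annihilator `Ann V = {μ | μ * f = 0 for all f in V}` in `M_c(G//K)`. -/
def annihilator (V : Submodule ℂ C(G, ℂ)) : Ideal (KMeas K) where
  carrier := {μ | ∀ f ∈ V, convFun (μ : CompactMeasure G) f = 0}
  add_mem' := fun {μ ν} hμ hν f hf => by
    ext x
    have h1 := DFunLike.congr_fun (hμ f hf) x
    have h2 := DFunLike.congr_fun (hν f hf) x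
    rw [convFun_apply] at h1 h2 ⊢
    rw [KMeas.add_apply, h1, h2]
    simp
  zero_mem' _ _ := rfl
  smul_mem' ν μ hμ f hf := by
    rw [smul_eq_mul, convFun_mul, hμ f hf, convFun_zero]

variable {K}

/-- An exponential maximal ideal: a maximal ideal which is the kernel of a continuous algebra
homomorphism of `M_c(G//K)` onto `ℂ`. -/
def IsExponential (M : Ideal (KMeas K)) : Prop :=
  M.IsMaximal ∧ ∃ Φ : KMeas K →ₐ[ℂ] ℂ, Continuous Φ ∧ Function.Surjective Φ ∧
    M = RingHom.ker Φ

/-- The power `M^n` as a closed ideal: the closure of the linear span of the products of `n`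
elements of `M`. -/
def closedPower (M : Ideal (KMeas K)) (n : ℕ) : Submodule ℂ (KMeas K) :=
  ((M ^ n).restrictScalars ℂ).topologicalClosure

variable (K)

/-! ### Spherical functions, spherical monomials, synthesis -/

/-- A `K`-spherical function: nonzero, `K`-invariant, with `∫ s (x k y) dω(k) = s x * s y`. -/
structure IsSpherical (s : C(G, ℂ)) : Prop where
  mem_KFun : s ∈ KFun K
  ne_zero : s ≠ 0
  integral_eq : ∀ x y : G, ∫ k : K, s (x * (k : G) * y) ∂(haarK K) = s x * s y

/-- The modified `K`-spherical difference `D_{s;y} = δ_{y⁻¹}^# - s(y) δ_e`, where `δ_e` is the unit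
of `M_c(G//K)`. -/
def sphDiff (s : C(G, ℂ)) (y : G) : KMeas K := deltaK K y⁻¹ - s y • (1 : KMeas K)

/-- A generalized `K`-spherical monomial: `D_{s;y_1} * ⋯ * D_{s;y_{n+1}} * φ = 0` for some
`K`-spherical function `s`, some `n`, and all `y_1, …, y_{n+1}`. -/
structure IsGenMonomial (φ : C(G, ℂ)) : Prop where
  mem_KFun : φ ∈ KFun K
  exists_eq_zero : ∃ s : C(G, ℂ), IsSpherical K s ∧ ∃ n : ℕ, ∀ y : Fin (n + 1) → G,
    convFun ((List.ofFn fun i => sphDiff K s (y i)).prod : CompactMeasure G) φ = 0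

/-- A `K`-spherical monomial: a generalized one generating a finite dimensional `K`-variety. -/
def IsMonomial (φ : C(G, ℂ)) : Prop :=
  IsGenMonomial K φ ∧ FiniteDimensional ℂ (generated K φ)

/-- `V` is `K`-synthesizable: the `K`-spherical monomials in `V` span a dense subspace of `V`. -/
def IsSynthesizable (V : Submodule ℂ C(G, ℂ)) : Prop :=
  V ≤ (Submodule.span ℂ {φ | φ ∈ V ∧ IsMonomial K φ}).topologicalClosure

end Pair

end

end SphericalSynthesis

open SphericalSynthesis

open MeasureTheory

namespace SphericalSynthesis

noncomputable section

/-! The pairing of `f` and `μ` by `(μ * f)(e)` puts C(G//K) and the algebra A = M_c(G//K) in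
duality: by `convFun_dualMeas_one` and `exists_eq_convFun_one` each continuous functional on one
side is represented on the other. For ideals and varieties, orthogonality for this pairing is the
same as annihilation by convolution, so a variety is recovered from its annihilator
(`mem_of_annihilator`).

Generalized monomials are exactly the functions in C(G//K) killed by some M^{n+1} with M exponential
(`IsGenMonomial.exists_pow_eq_zero`, `IsExponential.isGenMonomial`). This gives necessity: a measure
in Ann V + M^{n+1} kills every monomial of V that M^{n+1} kills, so a measure in the whole
intersection kills a dense subspace of V, hence V.

For sufficiency, if the monomials of V are not dense, Hahn–Banach gives a functional L that vanishes
on them but not on V. The measure representing L is not in Ann V, so it lies outside some Ann V +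
M^{n+1} of finite codimension. By `exists_separating` a function g separates it from that sum. Then
g is killed by Ann V, hence lies in V, and by M^{n+1}, hence is a monomial, yet L g ≠ 0. Finite
codimension serves twice: the separating functional is continuous, and τ(g) is finite dimensional.
-/

/-- Hahn–Banach: a point outside a closed subspace of `C(X, ℂ)` is separated from it by a
continuous linear functional. -/
theorem exists_functional_of_notMem {X : Type*} [TopologicalSpace X]
    (W : Submodule ℂ C(X, ℂ)) (hW : IsClosed (W : Set C(X, ℂ))) (f : C(X, ℂ)) (hf : f ∉ W) :
    ∃ L : C(X, ℂ) →L[ℂ] ℂ, (∀ g ∈ W, L g = 0) ∧ L f ≠ 0 := by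
  obtain ⟨L, u, hL, hu⟩ := RCLike.geometric_hahn_banach_closed_point (𝕜 := ℂ)
    (s := (W : Set C(X, ℂ))) (W.restrictScalars ℝ).convex hW hf
  have h0 : 0 < u := by simpa using hL 0 W.zero_mem
  have hzero : ∀ g ∈ W, L g = 0 := by
    intro g hg
    by_contra hne
    have h1 := hL (((u : ℂ) / L g) • g) (W.smul_mem _ hg)
    rw [map_smul, smul_eq_mul, div_mul_cancel₀ _ hne] at h1
    simp at h1
  refine ⟨L, hzero, fun h => ?_⟩
  rw [h] at hu
  simp only [map_zero] at hu
  linarith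

section Pair

set_option linter.unusedSectionVars false

variable {G : Type*} [Group G] [TopologicalSpace G] [IsTopologicalGroup G] [LocallyCompactSpace G]
  [T2Space G] [MeasurableSpace G] [BorelSpace G] {K : Subgroup G} [CompactSpace K]

/-- Only left invariance of the Haar measure is available. Integrating f(k⁻¹l) over K × K in both
orders yields one side from each order. -/
theorem integral_haarK_inv (f : K → ℂ) (hf : Continuous f) :
    ∫ k, f k⁻¹ ∂(haarK K) = ∫ k, f k ∂(haarK K) := by
  have h := integral_swap_K K (fun k l => f (k⁻¹ * l)) (by unfold Function.uncurry; fun_prop)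
  have h1 : ∀ k : K, ∫ l, f (k⁻¹ * l) ∂(haarK K) = ∫ l, f l ∂(haarK K) := fun k =>
    integral_mul_left_eq_self (μ := haarK K) f k⁻¹
  have h2 : ∀ l : K, ∫ k, f (k⁻¹ * l) ∂(haarK K) = ∫ k, f k⁻¹ ∂(haarK K) := fun l => by
    rw [← integral_mul_left_eq_self (μ := haarK K) (fun k : K => f k⁻¹) l⁻¹]
    simp
  simp only [h1, h2, integral_const, probReal_univ, one_smul] at h
  exact h.symm

/-! ### Functions and measures invariant under `K` -/

theorem KFun.apply_mul_right {f : C(G, ℂ)} (hf : f ∈ KFun K) (x : G) (k : K) :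
    f (x * k) = f x := by
  simpa using hf x 1 k

theorem KFun.apply_mul_left {f : C(G, ℂ)} (hf : f ∈ KFun K) (k : K) (x : G) :
    f (k * x) = f x := by
  simpa using hf x k 1

theorem proj_of_mem_KFun {f : C(G, ℂ)} (hf : f ∈ KFun K) : proj K f = f := by
  ext x
  rw [proj_apply]
  simp [hf x _ _]

theorem rightAvg_apply_mul (f : C(G, ℂ)) (x : G) (k : K) :
    rightAvg K f (x * k) = rightAvg K f x := by
  rw [rightAvg_apply, rightAvg_apply,
    ← integral_mul_left_eq_self (μ := haarK K) (fun l : K => f (x * l)) k]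
  simp [mul_assoc]

/-- Averaging over l⁻¹ instead of l turns the required right shift in K into a left shift. -/
theorem leftAvg_apply_mul (f : C(G, ℂ)) (k : K) (x : G) :
    leftAvg K f (k * x) = leftAvg K f x := by
  have h : ∀ y, leftAvg K f y = ∫ l : K, f ((l⁻¹ : K) * y) ∂(haarK K) := fun y => by
    rw [leftAvg_apply, ← integral_haarK_inv (fun l : K => f (l * y)) (by fun_prop)]
  rw [h, h, ← integral_mul_left_eq_self (μ := haarK K) (fun l : K => f ((l⁻¹ : K) * (k * x))) k]
  simp [mul_assoc]

theorem proj_mem_KFun (f : C(G, ℂ)) : proj K f ∈ KFun K := by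
  intro x k l
  have h : ∀ y : G, proj K f (y * l) = proj K f y := fun y => by
    rw [show proj K f = leftAvg K (rightAvg K f) from rfl, leftAvg_rightAvg, rightAvg_apply_mul]
  rw [h, show proj K f = leftAvg K (rightAvg K f) from rfl, leftAvg_apply_mul]

theorem KMeas.apply_comp_mul_left (μ : KMeas K) (f : C(G, ℂ)) (k : K) :
    (μ : CompactMeasure G) (f.comp ⟨fun y => (k : G) * y, by fun_prop⟩)
      = (μ : CompactMeasure G) f := by
  rw [← KMeas.apply_leftAvg μ, ← KMeas.apply_leftAvg μ f]
  congr 1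
  ext x
  rw [leftAvg_apply, leftAvg_apply]
  have h : ∀ l : K, (f.comp ⟨fun y => (k : G) * y, by fun_prop⟩) (l * x)
      = f (((k * l : K) : G) * x) := fun l => by simp [mul_assoc]
  simp only [h]
  exact integral_mul_left_eq_self (μ := haarK K) (fun l : K => f (l * x)) k

/-- The function `x ↦ f x⁻¹`. -/
def reflect : C(G, ℂ) →L[ℂ] C(G, ℂ) where
  toFun f := f.comp ⟨fun x => x⁻¹, by fun_prop⟩
  map_add' _ _ := rfl
  map_smul' _ _ := rfl
  cont := ContinuousMap.continuous_precomp _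

@[simp] theorem reflect_apply (f : C(G, ℂ)) (x : G) : reflect f x = f x⁻¹ := rfl

theorem reflect_reflect (f : C(G, ℂ)) : reflect (reflect f) = f := by
  ext x
  simp

theorem reflect_mem_KFun {f : C(G, ℂ)} (hf : f ∈ KFun K) : reflect f ∈ KFun K := by
  intro x k l
  have := hf x⁻¹ l⁻¹ k⁻¹
  simpa [mul_assoc] using this

/-! ### The action of measures on functions -/

/-- `f ↦ μ * f` as a continuous linear operator. -/
def convOp (μ : CompactMeasure G) : C(G, ℂ) →L[ℂ] C(G, ℂ) :=
  slice ⟨fun p : G × G => p.2⁻¹ * p.1, by fun_prop⟩ μ.toFunctional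

theorem convFun_add_left (μ ν : KMeas K) (f : C(G, ℂ)) :
    convFun ((μ + ν : KMeas K) : CompactMeasure G) f
      = convFun (μ : CompactMeasure G) f + convFun (ν : CompactMeasure G) f := rfl

theorem convFun_smul_left (c : ℂ) (μ : KMeas K) (f : C(G, ℂ)) :
    convFun ((c • μ : KMeas K) : CompactMeasure G) f
      = c • convFun (μ : CompactMeasure G) f := rfl

theorem convFun_sub_left (μ ν : KMeas K) (f : C(G, ℂ)) :
    convFun ((μ - ν : KMeas K) : CompactMeasure G) f
      = convFun (μ : CompactMeasure G) f - convFun (ν : CompactMeasure G) f := by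
  rw [eq_sub_iff_add_eq, ← convFun_add_left, sub_add_cancel]

theorem convFun_smul (μ : CompactMeasure G) (c : ℂ) (f : C(G, ℂ)) :
    convFun μ (c • f) = c • convFun μ f := map_smul (convOp μ) c f

theorem convFun_add (μ : CompactMeasure G) (f g : C(G, ℂ)) :
    convFun μ (f + g) = convFun μ f + convFun μ g := map_add (convOp μ) f g

theorem convFun_one_eq (μ : CompactMeasure G) (f : C(G, ℂ)) :
    convFun μ f 1 = μ (reflect f) := by
  rw [convFun_apply]
  congr 1
  ext y
  simp

theorem continuous_apply_measure (f : C(G, ℂ)) :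
    Continuous fun μ : KMeas K => (μ : CompactMeasure G) f :=
  (WeakDual.eval_continuous (𝕜 := ℂ) (E := C(G, ℂ)) f).comp continuous_subtype_val

theorem continuous_convFun_apply (f : C(G, ℂ)) (x : G) :
    Continuous fun μ : KMeas K => convFun (μ : CompactMeasure G) f x :=
  continuous_apply_measure _

theorem convFun_mem_KFun (μ : KMeas K) {f : C(G, ℂ)} (hf : f ∈ KFun K) :
    convFun (μ : CompactMeasure G) f ∈ KFun K := by
  intro x k l
  rw [convFun_apply, convFun_apply, ← KMeas.apply_comp_mul_left μ _ k]
  congr 1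
  ext y
  have := KFun.apply_mul_right hf (y⁻¹ * x) l
  simpa [mul_assoc] using this

theorem translate_mem_KFun (y : G) {f : C(G, ℂ)} (hf : f ∈ KFun K) : translate K y f ∈ KFun K :=
  convFun_mem_KFun _ hf

/-- Inverting k y⁻¹ l leaves l⁻¹ y k⁻¹: left invariance of f absorbs the outer factor, and only the
average between y and x survives. -/
theorem translate_apply (y : G) {f : C(G, ℂ)} (hf : f ∈ KFun K) (x : G) :
    translate K y f x = ∫ k : K, f (y * k * x) ∂(haarK K) := by
  rw [translate, convFun_apply, deltaK_apply, proj_apply,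
    ← integral_haarK_inv (fun k : K => f (y * k * x)) (by fun_prop)]
  congr 1
  ext k
  have h : ∀ l : K, (f.comp ⟨fun z => z⁻¹ * x, by fun_prop⟩) (k * y⁻¹ * l)
      = f (y * (k⁻¹ : K) * x) := fun l => by
    rw [← KFun.apply_mul_left hf l⁻¹ (y * (k⁻¹ : K) * x)]
    simp [mul_assoc]
  simp only [h]
  simp

theorem translate_apply_one (y : G) {f : C(G, ℂ)} (hf : f ∈ KFun K) :
    translate K y f 1 = f y := by
  rw [translate_apply y hf]
  simp [KFun.apply_mul_right hf]

/-- Evaluation at x is reduced to evaluation at e, so that facts about the scalar pairing become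
facts about functions. -/
theorem convFun_deltaK_mul (μ : KMeas K) {f : C(G, ℂ)} (hf : f ∈ KFun K) (x : G) :
    convFun ((deltaK K x⁻¹ * μ : KMeas K) : CompactMeasure G) f 1
      = convFun (μ : CompactMeasure G) f x := by
  rw [convFun_mul]
  exact translate_apply_one x (convFun_mem_KFun μ hf)

theorem convFun_one {f : C(G, ℂ)} (hf : f ∈ KFun K) :
    convFun ((1 : KMeas K) : CompactMeasure G) f = f := by
  ext x
  rw [← convFun_deltaK_mul 1 hf, mul_one]
  exact translate_apply_one x hf

theorem convFun_comm (hK : IsGelfandPair K) (μ ν : KMeas K) (f : C(G, ℂ)) :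
    convFun (μ : CompactMeasure G) (convFun (ν : CompactMeasure G) f)
      = convFun (ν : CompactMeasure G) (convFun (μ : CompactMeasure G) f) := by
  rw [← convFun_mul, hK, convFun_mul]

theorem convFun_apply_eq_translate (hK : IsGelfandPair K) (μ : KMeas K) {f : C(G, ℂ)} (hf : f ∈ KFun K) (x : G) :
    convFun (μ : CompactMeasure G) f x = convFun (μ : CompactMeasure G) (translate K x f) 1 := by
  rw [← convFun_deltaK_mul μ hf, hK, convFun_mul]
  rfl

/-! ### Duality -/

/-- The `K`-invariant measure `μ` with `(μ * f)(e) = L f` for `f` in `C(G//K)`. -/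
def dualMeas (L : C(G, ℂ) →L[ℂ] ℂ) : KMeas K :=
  ⟨measProj K (.of (L.comp reflect)), measProj_mem _⟩

theorem convFun_dualMeas_one (L : C(G, ℂ) →L[ℂ] ℂ) {f : C(G, ℂ)} (hf : f ∈ KFun K) :
    convFun (dualMeas L : KMeas K).1 f 1 = L f := by
  rw [convFun_one_eq]
  show L (reflect (proj K (reflect f))) = L f
  rw [proj_of_mem_KFun (reflect_mem_KFun hf), reflect_reflect]

theorem convFun_dualMeas (hK : IsGelfandPair K) (L : C(G, ℂ) →L[ℂ] ℂ) {f : C(G, ℂ)}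
    (hf : f ∈ KFun K) (x : G) :
    convFun (dualMeas L : KMeas K).1 f x = L (translate K x f) := by
  rw [convFun_apply_eq_translate hK _ hf, convFun_dualMeas_one L (translate_mem_KFun x hf)]

/-- Bipolar argument: if L vanishes on V, translation invariance gives L(τ_x g) = 0 for g in V, so
the measure representing L lies in Ann V and must kill f. -/
theorem mem_of_annihilator (hK : IsGelfandPair K) {V : Submodule ℂ C(G, ℂ)} (hV : IsVariety K V)
    {f : C(G, ℂ)} (hf : f ∈ KFun K)
    (h : ∀ μ ∈ annihilator K V, convFun (μ : CompactMeasure G) f = 0) : f ∈ V := by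
  by_contra hne
  obtain ⟨L, hL, hLf⟩ := exists_functional_of_notMem V hV.isClosed f hne
  apply hLf
  rw [← convFun_dualMeas_one (K := K) L hf, h]
  · rfl
  · intro g hg
    ext x
    rw [convFun_dualMeas hK L (hV.le_KFun hg)]
    exact hL _ (hV.translate_mem g hg x)

theorem weakDual_exists_eq_apply {E : Type*} [AddCommGroup E] [Module ℂ E] [TopologicalSpace E]
    (Φ : WeakDual ℂ E →ₗ[ℂ] ℂ) (hΦ : Continuous Φ) : ∃ g : E, ∀ μ : WeakDual ℂ E, Φ μ = μ g := by
  obtain ⟨g, hg⟩ := LinearMap.dualEmbedding_surjective (topDualPairing ℂ E)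
    (⟨Φ, hΦ⟩ : WeakDual ℂ E →L[ℂ] ℂ)
  exact ⟨g, fun μ => (DFunLike.congr_fun hg μ).symm⟩

theorem CompactMeasure.exists_eq_apply (Φ : CompactMeasure G →ₗ[ℂ] ℂ) (hΦ : Continuous Φ) :
    ∃ g : C(G, ℂ), ∀ μ : CompactMeasure G, Φ μ = μ g :=
  weakDual_exists_eq_apply (E := C(G, ℂ)) Φ hΦ

variable (K) in
/-- The projection `μ ↦ μ^#` onto `M_c(G//K)` as a linear map. -/
def measProjL : CompactMeasure G →ₗ[ℂ] KMeas K where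
  toFun μ := ⟨measProj K μ, measProj_mem μ⟩
  map_add' _ _ := rfl
  map_smul' _ _ := rfl

theorem continuous_measProjL : Continuous (measProjL K) :=
  Continuous.subtype_mk (WeakDual.continuous_of_continuous_eval (𝕜 := ℂ) (E := C(G, ℂ)) fun f =>
    WeakDual.eval_continuous (𝕜 := ℂ) (E := C(G, ℂ)) (proj K f)) _

/-- A weak-* continuous linear functional on `M_c(G//K)` is `μ ↦ (μ * f)(e)` for some `f` in
`C(G//K)`. -/
theorem exists_eq_convFun_one (Φ : KMeas K →ₗ[ℂ] ℂ) (hΦ : Continuous Φ) :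
    ∃ f ∈ KFun K, ∀ μ : KMeas K, Φ μ = convFun (μ : CompactMeasure G) f 1 := by
  -- The continuous projection extends Φ to all of M_c(G), where weak-* continuous functionals are
  -- evaluations.
  obtain ⟨g, hg⟩ := CompactMeasure.exists_eq_apply (Φ.comp (measProjL K))
    (hΦ.comp continuous_measProjL)
  refine ⟨reflect (proj K g), reflect_mem_KFun (proj_mem_KFun g), fun μ => ?_⟩
  have h1 : measProjL K μ = μ := KMeas.ext_apply fun f => (μ.2 f).symm
  have h2 := hg (μ : CompactMeasure G)
  rw [LinearMap.comp_apply, h1] at h2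
  rw [h2, convFun_one_eq, reflect_reflect, KMeas.apply_proj]

/-! ### Spherical functions and exponential maximal ideals -/

theorem IsSpherical.translate_eq {s : C(G, ℂ)} (hs : IsSpherical K s) (x : G) :
    translate K x s = s x • s := by
  ext y
  rw [translate_apply x hs.mem_KFun, hs.integral_eq]
  rfl

theorem IsSpherical.apply_one {s : C(G, ℂ)} (hs : IsSpherical K s) : s 1 = 1 := by
  obtain ⟨x, hx⟩ := DFunLike.ne_iff.mp hs.ne_zero
  have h := translate_apply_one x hs.mem_KFun
  rw [hs.translate_eq] at h
  exact mul_left_cancel₀ hx (by simpa using h)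

/-- Since A is commutative, an eigenfunction of all translations is an eigenfunction of every
measure. -/
theorem IsSpherical.convFun_eq (hK : IsGelfandPair K) {s : C(G, ℂ)} (hs : IsSpherical K s)
    (μ : KMeas K) :
    convFun (μ : CompactMeasure G) s = convFun (μ : CompactMeasure G) s 1 • s := by
  ext x
  rw [convFun_apply_eq_translate hK μ hs.mem_KFun, hs.translate_eq, convFun_smul]
  simp [mul_comm]

/-- The character `μ ↦ (μ * s)(e)` of `M_c(G//K)` given by a spherical function `s`. -/
def IsSpherical.char (hK : IsGelfandPair K) {s : C(G, ℂ)} (hs : IsSpherical K s) :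
    KMeas K →ₐ[ℂ] ℂ :=
  AlgHom.ofLinearMap
    { toFun := fun μ => convFun (μ : CompactMeasure G) s 1
      map_add' := fun _ _ => rfl
      map_smul' := fun _ _ => rfl }
    (by
      show convFun ((1 : KMeas K) : CompactMeasure G) s 1 = 1
      rw [convFun_one hs.mem_KFun, hs.apply_one])
    (fun μ ν => by
      show convFun ((μ * ν : KMeas K) : CompactMeasure G) s 1 = _
      rw [convFun_mul, hs.convFun_eq hK ν, convFun_smul]
      exact mul_comm _ _)

theorem IsSpherical.char_apply (hK : IsGelfandPair K) {s : C(G, ℂ)} (hs : IsSpherical K s)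
    (μ : KMeas K) : hs.char hK μ = convFun (μ : CompactMeasure G) s 1 := rfl

theorem isExponential_ker (Φ : KMeas K →ₐ[ℂ] ℂ) (hΦ : Continuous Φ) :
    IsExponential (RingHom.ker Φ) := by
  have hsurj : Function.Surjective Φ := fun c => ⟨algebraMap ℂ _ c, by simp⟩
  exact ⟨RingHom.ker_isMaximal_of_surjective Φ hsurj, Φ, hΦ, hsurj, rfl⟩

theorem IsSpherical.isExponential (hK : IsGelfandPair K) {s : C(G, ℂ)} (hs : IsSpherical K s) :
    IsExponential (RingHom.ker (hs.char hK)) :=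
  isExponential_ker _ (continuous_convFun_apply s 1)

/-- The function s representing the character Φ satisfies Φ(δ_{y⁻¹}^#) = s(y), so multiplicativity
of Φ on these measures is the spherical functional equation. -/
theorem IsExponential.exists_isSpherical {M : Ideal (KMeas K)} (hM : IsExponential M) :
    ∃ s : C(G, ℂ), IsSpherical K s ∧ ∀ y : G, sphDiff K s y ∈ M := by
  obtain ⟨-, Φ, hΦ, -, rfl⟩ := hM
  obtain ⟨s, hs, hΦs⟩ := exists_eq_convFun_one Φ.toLinearMap hΦ
  have hΦs : ∀ μ : KMeas K, Φ μ = convFun (μ : CompactMeasure G) s 1 := hΦs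
  have hδ : ∀ y : G, Φ (deltaK K y⁻¹) = s y := fun y =>
    (hΦs _).trans (translate_apply_one y hs)
  refine ⟨s, ⟨hs, ?_, fun x y => ?_⟩, fun y => ?_⟩
  · rintro rfl
    have h := hΦs 1
    rw [map_one, convFun_zero] at h
    exact one_ne_zero h
  · calc ∫ k : K, s (x * k * y) ∂(haarK K)
        = translate K y (translate K x s) 1 := by
          rw [translate_apply_one y (translate_mem_KFun x hs), translate_apply x hs]
      _ = Φ (deltaK K y⁻¹ * deltaK K x⁻¹) := by
          rw [hΦs, convFun_mul]
          rfl
      _ = s x * s y := by rw [map_mul, hδ, hδ, mul_comm]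
  · rw [RingHom.mem_ker, sphDiff, map_sub, map_smul, map_one, hδ]
    simp

/-! ### Annihilation by powers of exponential maximal ideals -/

theorem convFun_smul_eq_zero {μ : CompactMeasure G} {f : C(G, ℂ)} (h : convFun μ f = 0) (c : ℂ) :
    convFun μ (c • f) = 0 :=
  Submodule.smul_mem (LinearMap.ker (convOp μ).toLinearMap) c h

/-- Measures killing one function form an ideal, so vanishing on a power of M can be tested on
products. -/
theorem mem_annihilator_span_singleton {μ : KMeas K} {f : C(G, ℂ)} :
    μ ∈ annihilator K (ℂ ∙ f) ↔ convFun (μ : CompactMeasure G) f = 0 := by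
  refine ⟨fun h => h f (Submodule.mem_span_singleton_self f), fun h g hg => ?_⟩
  obtain ⟨c, rfl⟩ := Submodule.mem_span_singleton.mp hg
  exact convFun_smul_eq_zero h c

theorem convFun_eq_zero_of_mem_closedPower {M : Ideal (KMeas K)} {n : ℕ} {f : C(G, ℂ)}
    (h : ∀ μ ∈ M ^ n, convFun (μ : CompactMeasure G) f = 0) {μ : KMeas K}
    (hμ : μ ∈ closedPower M n) : convFun (μ : CompactMeasure G) f = 0 := by
  ext x
  have hcl : IsClosed {ν : KMeas K | convFun (ν : CompactMeasure G) f x = 0} :=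
    isClosed_eq (continuous_convFun_apply f x) continuous_const
  refine closure_minimal (fun ν hν => ?_) hcl hμ
  exact DFunLike.congr_fun (h ν hν) x

theorem eq_smul_of_sphDiff_eq_zero {s f : C(G, ℂ)} (hf : f ∈ KFun K)
    (h : ∀ y, convFun (sphDiff K s y : CompactMeasure G) f = 0) : f = f 1 • s := by
  ext y
  have h1 := DFunLike.congr_fun (h y) 1
  rw [sphDiff, convFun_sub_left, convFun_smul_left, convFun_one hf, ContinuousMap.sub_apply,
    show convFun (deltaK K y⁻¹ : CompactMeasure G) f 1 = f y from translate_apply_one y hf] at h1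
  simpa [mul_comm] using sub_eq_zero.mp h1

/-- The differences D_{s;y} are not shown to generate the kernel M. Instead, for ρ in M^n, induction
applied to D_{s;y} * f gives D_{s;y} * (ρ * f) = 0 for all y. Hence ρ * f is a multiple of s, and
every ν in M kills s. -/
theorem IsSpherical.convFun_eq_zero_of_mem_pow (hK : IsGelfandPair K) {s : C(G, ℂ)}
    (hs : IsSpherical K s) (n : ℕ) : ∀ {f : C(G, ℂ)}, f ∈ KFun K →
    (∀ l : List G, l.length = n →
      convFun ((l.map (sphDiff K s)).prod : CompactMeasure G) f = 0) →
    ∀ μ ∈ RingHom.ker (hs.char hK) ^ n, convFun (μ : CompactMeasure G) f = 0 := by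
  induction n with
  | zero =>
    intro f hf h μ _
    have h0 := h [] rfl
    rw [List.map_nil, List.prod_nil, convFun_one hf] at h0
    rw [h0, convFun_zero]
  | succ n ih =>
    intro f hf h μ hμ
    rw [Submodule.pow_succ] at hμ
    refine mem_annihilator_span_singleton.mp (Ideal.mul_le.mpr (fun ρ hρ ν hν => ?_) hμ)
    rw [mem_annihilator_span_singleton, convFun_mul, convFun_comm hK,
      eq_smul_of_sphDiff_eq_zero (s := s) (convFun_mem_KFun ρ hf) fun y => ?_]
    · refine convFun_smul_eq_zero ?_ _
      rw [hs.convFun_eq hK, ← hs.char_apply hK, RingHom.mem_ker.mp hν]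
      ext x
      exact zero_mul _
    rw [convFun_comm hK]
    refine ih (convFun_mem_KFun _ hf) (fun l hl => ?_) ρ hρ
    rw [← convFun_mul]
    simpa using h (l ++ [y]) (by simp [hl])

theorem IsGenMonomial.exists_pow_eq_zero (hK : IsGelfandPair K) {f : C(G, ℂ)}
    (hf : IsGenMonomial K f) : ∃ M : Ideal (KMeas K), IsExponential M ∧ ∃ n : ℕ,
      ∀ μ ∈ M ^ (n + 1), convFun (μ : CompactMeasure G) f = 0 := by
  obtain ⟨hfK, s, hs, n, h⟩ := hf
  refine ⟨_, hs.isExponential hK, n,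
    hs.convFun_eq_zero_of_mem_pow hK (n + 1) hfK fun l hl => ?_⟩
  have h1 : List.ofFn (fun i : Fin (n + 1) => sphDiff K s (l.get (i.cast hl.symm)))
      = l.map (sphDiff K s) := by
    refine List.ext_getElem (by simp [hl]) fun i _ _ => ?_
    rw [List.getElem_ofFn, List.getElem_map]
    rfl
  rw [← h1]
  exact h _

theorem convFun_pow_of_eq {μ : KMeas K} {f : C(G, ℂ)} (hf : f ∈ KFun K)
    (h : convFun (μ : CompactMeasure G) f = f) (n : ℕ) :
    convFun ((μ ^ n : KMeas K) : CompactMeasure G) f = f := by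
  induction n with
  | zero => rw [pow_zero, convFun_one hf]
  | succ n ih => rw [pow_succ, convFun_mul, h, ih]

/-- If ν in Ann V had Φ ν ≠ 0, then 1 - ν/Φ(ν) would lie in M and fix f, while its n-th power kills
f. -/
theorem IsExponential.annihilator_le {M : Ideal (KMeas K)} (hM : IsExponential M)
    {V : Submodule ℂ C(G, ℂ)} {f : C(G, ℂ)} (hfV : f ∈ V) (hf : f ∈ KFun K) (hf0 : f ≠ 0) {n : ℕ}
    (h : ∀ μ ∈ M ^ n, convFun (μ : CompactMeasure G) f = 0) : annihilator K V ≤ M := by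
  obtain ⟨-, Φ, -, -, rfl⟩ := hM
  intro ν hν
  by_contra hne
  have hne : Φ ν ≠ 0 := hne
  have hmem : (1 - (Φ ν)⁻¹ • ν : KMeas K) ∈ RingHom.ker Φ := by
    rw [RingHom.mem_ker, map_sub, map_one, map_smul, smul_eq_mul, inv_mul_cancel₀ hne, sub_self]
  have hfix : convFun ((1 - (Φ ν)⁻¹ • ν : KMeas K) : CompactMeasure G) f = f := by
    rw [convFun_sub_left, convFun_smul_left, hν f hfV, convFun_one hf]
    ext x
    show f x - (Φ ν)⁻¹ * 0 = f x
    rw [mul_zero, sub_zero]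
  apply hf0
  rw [← convFun_pow_of_eq hf hfix n]
  exact h _ (Ideal.pow_mem_pow hmem n)

theorem IsExponential.isGenMonomial {M : Ideal (KMeas K)} (hM : IsExponential M) {f : C(G, ℂ)}
    (hf : f ∈ KFun K) {n : ℕ} (h : ∀ μ ∈ M ^ (n + 1), convFun (μ : CompactMeasure G) f = 0) :
    IsGenMonomial K f := by
  obtain ⟨s, hs, hsM⟩ := hM.exists_isSpherical
  have hprod : ∀ l : List (KMeas K), (∀ μ ∈ l, μ ∈ M) → l.prod ∈ M ^ l.length := by
    intro l
    induction l with
    | nil => simp [Submodule.pow_zero, Ideal.one_eq_top]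
    | cons μ l ih =>
      intro hl
      rw [List.prod_cons, List.length_cons]
      rcases Nat.eq_zero_or_pos l.length with h0 | h0
      · rw [List.length_eq_zero_iff.mp h0]
        simpa [Submodule.pow_one] using hl μ (by simp)
      · rw [Submodule.pow_succ' M h0.ne']
        exact Ideal.mul_mem_mul (hl μ (by simp)) (ih fun ν hν => hl ν (by simp [hν]))
  refine ⟨hf, s, hs, n, fun y => h _ ?_⟩
  have := hprod (List.ofFn fun i => sphDiff K s (y i)) (by
    intro μ hμ
    obtain ⟨i, rfl⟩ := (List.mem_ofFn' _ _).mp hμ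
    exact hsM _)
  simpa using this

/-! ### Functions annihilated by a space of measures -/

/-- The functions in `C(G//K)` annihilated by all measures in `N`. -/
def convOrtho (N : Submodule ℂ (KMeas K)) : Submodule ℂ C(G, ℂ) where
  carrier := {f | f ∈ KFun K ∧ ∀ μ ∈ N, convFun (μ : CompactMeasure G) f = 0}
  add_mem' hf hg := ⟨add_mem hf.1 hg.1, fun μ hμ => by
    rw [convFun_add, hf.2 μ hμ, hg.2 μ hμ, add_zero]⟩
  zero_mem' := ⟨zero_mem _, fun μ _ => convFun_zero _⟩
  smul_mem' c f hf := ⟨Submodule.smul_mem _ c hf.1, fun μ hμ => convFun_smul_eq_zero (hf.2 μ hμ) c⟩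

theorem isClosed_KFun : IsClosed (KFun K : Set C(G, ℂ)) := by
  have h : (KFun K : Set C(G, ℂ)) = ⋂ (x : G) (k : K) (l : K), {f | f (k * x * l) = f x} := by
    ext f
    simp only [Set.mem_iInter]
    rfl
  rw [h]
  exact isClosed_iInter fun x => isClosed_iInter fun k => isClosed_iInter fun l =>
    isClosed_eq (continuous_eval_const _) (continuous_eval_const _)

theorem isVariety_convOrtho (hK : IsGelfandPair K) (N : Submodule ℂ (KMeas K)) :
    IsVariety K (convOrtho N) where
  le_KFun _ hf := hf.1
  isClosed := by
    have h : (convOrtho N : Set C(G, ℂ))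
        = (KFun K : Set C(G, ℂ)) ∩ ⋂ μ ∈ N, {f | convOp (μ : CompactMeasure G) f = 0} := by
      ext f
      simp only [Set.mem_inter_iff, Set.mem_iInter]
      rfl
    rw [h]
    exact isClosed_KFun.inter (isClosed_biInter fun μ _ =>
      isClosed_eq (convOp (μ : CompactMeasure G)).continuous continuous_const)
  translate_mem f hf y := ⟨translate_mem_KFun y hf.1, fun μ hμ => by
    rw [translate, convFun_comm hK, hf.2 μ hμ, convFun_zero]⟩

/-- The pairing `(f, μ) ↦ (μ * f)(e)`. -/
def evalPairing : C(G, ℂ) →ₗ[ℂ] KMeas K →ₗ[ℂ] ℂ where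
  toFun f :=
    { toFun := fun μ => convFun (μ : CompactMeasure G) f 1
      map_add' := fun _ _ => rfl
      map_smul' := fun _ _ => rfl }
  map_add' f g := by
    ext μ
    exact DFunLike.congr_fun (convFun_add (μ : CompactMeasure G) f g) 1
  map_smul' c f := by
    ext μ
    exact DFunLike.congr_fun (convFun_smul (μ : CompactMeasure G) c f) 1

/-- The pairing embeds these functions in the dual of A/N; injectivity holds because δ_{x⁻¹}^#
recovers f(x). -/
theorem finiteDimensional_convOrtho (N : Submodule ℂ (KMeas K))
    [FiniteDimensional ℂ (KMeas K ⧸ N)] : FiniteDimensional ℂ (convOrtho N) := by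
  have : FiniteDimensional ℂ N.dualAnnihilator :=
    Module.Finite.equiv N.dualQuotEquivDualAnnihilator
  let T : convOrtho N →ₗ[ℂ] N.dualAnnihilator :=
    ((evalPairing (K := K)).comp (convOrtho N).subtype).codRestrict N.dualAnnihilator fun f =>
      (Submodule.mem_dualAnnihilator _).mpr fun μ hμ => DFunLike.congr_fun (f.2.2 μ hμ) 1
  refine FiniteDimensional.of_injective T fun f g hfg => ?_
  ext x
  have h := DFunLike.congr_fun (congrArg Subtype.val hfg) (deltaK K x⁻¹)
  exact (translate_apply_one x f.2.1).symm.trans (h.trans (translate_apply_one x g.2.1))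

theorem finiteDimensional_generated (hK : IsGelfandPair K) {N : Submodule ℂ (KMeas K)}
    [FiniteDimensional ℂ (KMeas K ⧸ N)] {f : C(G, ℂ)} (hf : f ∈ convOrtho N) :
    FiniteDimensional ℂ (generated K f) := by
  have := finiteDimensional_convOrtho N
  exact Submodule.finiteDimensional_of_le (S₂ := convOrtho N)
    (sInf_le ⟨isVariety_convOrtho hK N, hf⟩)

/-- Subspaces of `M_c(G//K)` containing a closed subspace of finite codimension are determined by
the functions in `C(G//K)` orthogonal to them. -/
theorem exists_separating {N P : Submodule ℂ (KMeas K)} (hN : IsClosed (N : Set (KMeas K)))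
    [FiniteDimensional ℂ (KMeas K ⧸ N)] (hNP : N ≤ P) {μ : KMeas K} (hμ : μ ∉ P) :
    ∃ f ∈ KFun K, (∀ ν ∈ P, convFun (ν : CompactMeasure G) f 1 = 0) ∧
      convFun (μ : CompactMeasure G) f 1 ≠ 0 := by
  obtain ⟨Φ, hΦμ, hΦ⟩ := Submodule.exists_le_ker_of_notMem hμ
  -- The kernel contains the closed subspace N of finite codimension, so it is closed; P itself need
  -- not be assumed closed.
  have hcont : Continuous Φ := by
    rw [LinearMap.continuous_iff_isClosed_ker]
    exact Submodule.isClosed_mono_of_finiteDimensional_quotient hN (hNP.trans hΦ)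
  obtain ⟨f, hf, hfΦ⟩ := exists_eq_convFun_one Φ hcont
  exact ⟨f, hf, fun ν hν => (hfΦ ν).symm.trans (hΦ hν), fun h => hΦμ ((hfΦ μ).trans h)⟩

/-- An ideal absorbs δ_{x⁻¹}^#, which carries vanishing at e to vanishing at every x. -/
theorem convFun_eq_zero_of_ideal {I : Ideal (KMeas K)} {f : C(G, ℂ)} (hf : f ∈ KFun K)
    (h : ∀ μ ∈ I, convFun (μ : CompactMeasure G) f 1 = 0) :
    ∀ μ ∈ I, convFun (μ : CompactMeasure G) f = 0 := by
  intro μ hμ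
  ext x
  rw [← convFun_deltaK_mul μ hf]
  exact h _ (I.mul_mem_left _ hμ)

/-! ### Synthesis -/

theorem annihilator_eq_iInf_of_isSynthesizable (hK : IsGelfandPair K) {V : Submodule ℂ C(G, ℂ)}
    (hV : IsSynthesizable K V) :
    (annihilator K V).restrictScalars ℂ =
      ⨅ (M : Ideal (KMeas K)) (_ : IsExponential M) (_ : annihilator K V ≤ M) (n : ℕ),
        (annihilator K V).restrictScalars ℂ ⊔ closedPower M (n + 1) := by
  refine le_antisymm (le_iInf fun M => le_iInf fun _ => le_iInf fun _ => le_iInf fun n =>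
    le_sup_left) fun μ hμ => ?_
  simp only [Submodule.mem_iInf] at hμ
  have hspan : Submodule.span ℂ {φ | φ ∈ V ∧ IsMonomial K φ}
      ≤ LinearMap.ker (convOp (μ : CompactMeasure G)).toLinearMap := by
    refine Submodule.span_le.mpr ?_
    rintro φ ⟨hφV, hφ, -⟩
    show convFun (μ : CompactMeasure G) φ = 0
    -- Only a nonzero φ forces Ann V ⊆ M, which is needed for M to occur in the intersection.
    rcases eq_or_ne φ 0 with rfl | hφ0
    · exact convFun_zero _
    obtain ⟨M, hM, n, hn⟩ := hφ.exists_pow_eq_zero hK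
    obtain ⟨ν, hν, ρ, hρ, rfl⟩ := Submodule.mem_sup.mp
      (hμ M hM (hM.annihilator_le hφV hφ.mem_KFun hφ0 hn) n)
    rw [convFun_add_left, hν φ hφV, convFun_eq_zero_of_mem_closedPower hn hρ, add_zero]
  intro f hf
  exact Submodule.topologicalClosure_minimal _ hspan
    (convOp (μ : CompactMeasure G)).isClosed_ker (hV hf)

theorem isSynthesizable_of_annihilator_eq_iInf (hK : IsGelfandPair K) {V : Submodule ℂ C(G, ℂ)}
    (hV : IsVariety K V)
    (h : (annihilator K V).restrictScalars ℂ =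
      ⨅ (M : Ideal (KMeas K)) (_ : IsExponential M) (_ : annihilator K V ≤ M) (n : ℕ)
        (_ : FiniteDimensional ℂ (KMeas K ⧸ closedPower M (n + 1))),
        (annihilator K V).restrictScalars ℂ ⊔ closedPower M (n + 1)) :
    IsSynthesizable K V := by
  intro f hf
  by_contra hne
  obtain ⟨L, hL, hLf⟩ := exists_functional_of_notMem _
    (Submodule.isClosed_topologicalClosure _) f hne
  have hLm : ∀ g ∈ V, IsMonomial K g → L g = 0 := fun g hgV hg =>
    hL g (Submodule.le_topologicalClosure _ (Submodule.subset_span ⟨hgV, hg⟩))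
  -- Membership in Ann V would give L f = (`dualMeas L` * f)(e) = 0.
  suffices hmem : (dualMeas L : KMeas K) ∈ (annihilator K V).restrictScalars ℂ by
    apply hLf
    rw [← convFun_dualMeas_one (K := K) L (hV.le_KFun hf), hmem f hf]
    rfl
  rw [h]
  simp only [Submodule.mem_iInf]
  intro M hM _ n hfin
  by_contra hnot
  obtain ⟨g, hgK, hg, hLg⟩ := exists_separating (N := closedPower M (n + 1))
    (Submodule.isClosed_topologicalClosure _) le_sup_right hnot
  have hpow : ∀ μ ∈ M ^ (n + 1), convFun (μ : CompactMeasure G) g = 0 :=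
    convFun_eq_zero_of_ideal hgK fun μ hμ =>
      hg μ ((le_sup_right : closedPower M (n + 1) ≤ _) (Submodule.le_topologicalClosure _ hμ))
  -- Orthogonality to the summand Ann V puts g in V; orthogonality to the other summand makes it a
  -- monomial.
  have hgV : g ∈ V := mem_of_annihilator hK hV hgK <|
    convFun_eq_zero_of_ideal hgK fun μ hμ =>
      hg μ ((le_sup_left : (annihilator K V).restrictScalars ℂ ≤ _) hμ)
  have hgen : FiniteDimensional ℂ (generated K g) :=
    finiteDimensional_generated hK (N := closedPower M (n + 1))
      ⟨hgK, fun μ hμ => convFun_eq_zero_of_mem_closedPower hpow hμ⟩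
  rw [convFun_dualMeas_one L hgK] at hLg
  exact hLg (hLm g hgV ⟨hM.isGenMonomial hgK hpow, hgen⟩)

end Pair

end

end SphericalSynthesis

theorem mainTheorem7 {G : Type*} [Group G] [TopologicalSpace G] [IsTopologicalGroup G]
    [LocallyCompactSpace G] [T2Space G] [MeasurableSpace G] [BorelSpace G]
    (K : Subgroup G) [CompactSpace K] (hGK : IsGelfandPair K)
    (V : Submodule ℂ C(G, ℂ)) (hV : IsVariety K V) (hV0 : V ≠ ⊥) :
    -- the equivalence, when the quotients `M_c(G//K) / M^(n+1)` are finite dimensional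
    ((∀ M : Ideal (KMeas K), IsExponential M → annihilator K V ≤ M →
        ∀ n : ℕ, FiniteDimensional ℂ (KMeas K ⧸ closedPower M (n + 1))) →
      (IsSynthesizable K V ↔
        (annihilator K V).restrictScalars ℂ =
          ⨅ (M : Ideal (KMeas K)) (_ : IsExponential M) (_ : annihilator K V ≤ M) (n : ℕ),
            (annihilator K V).restrictScalars ℂ ⊔ closedPower M (n + 1))) ∧
    -- necessity, without any assumption on the quotients
    (IsSynthesizable K V →
      (annihilator K V).restrictScalars ℂ =
        ⨅ (M : Ideal (KMeas K)) (_ : IsExponential M) (_ : annihilator K V ≤ M) (n : ℕ),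
          (annihilator K V).restrictScalars ℂ ⊔ closedPower M (n + 1)) ∧
    -- sufficiency, with the intersection restricted to the finite dimensional quotients
    ((annihilator K V).restrictScalars ℂ =
        ⨅ (M : Ideal (KMeas K)) (_ : IsExponential M) (_ : annihilator K V ≤ M) (n : ℕ)
          (_ : FiniteDimensional ℂ (KMeas K ⧸ closedPower M (n + 1))),
          (annihilator K V).restrictScalars ℂ ⊔ closedPower M (n + 1) →
      IsSynthesizable K V) := by

  refine ⟨fun hfin => ⟨annihilator_eq_iInf_of_isSynthesizable hGK, fun h =>
    isSynthesizable_of_annihilator_eq_iInf hGK hV (h.trans ?_)⟩,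
    annihilator_eq_iInf_of_isSynthesizable hGK, isSynthesizable_of_annihilator_eq_iInf hGK hV⟩
  -- With all the quotients finite dimensional, the restricted and unrestricted intersections agree
  -- term by term.
  refine iInf_congr fun M => iInf_congr fun hM => iInf_congr fun hle => iInf_congr fun n => ?_
  rw [iInf_pos (hfin M hM hle n)]
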